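/- Let $K$ be a field that is complete with respect to a discrete valuation $v$, normalized by $v(K^\times)=\mathbb Z$, with residue field $\tilde K$. Let $K_{\rm alg}$ be an algebraic closure of $K$, let $v$ also denote the unique extension of $v$ to $K_{\rm alg}$ and to its completion $\mathbb C_K$, and let $G_K={\rm Aut}_K(K_{\rm alg})$ act on $\mathbb C_K$ by continuity. For $a\in\mathbb C_K$ and $r\in\mathbb R\cup\{\infty\}$ put $D(a,r)=\{b\in\mathbb C_K : v(b-a)\ge r\}$. For a field $L$ with $K\subset L\subset K_{\rm alg}$, write $\tilde L$ for its residue field, regarded as a subfield of the residue field of $K_{\rm alg}$. A finite extension $L/K$ is *weakly totally ramified* if $\tilde L/\tilde K$ is purely inseparable; it is *weakly totally wildly ramified* if moreover its ramification index $[v(L^\times):v(K^\times)]$ is a power of the residue characteristic of $K$ (with the convention $0^0=1$, so that in residue characteristic $0$ the index is $1$). Let $D=D(a,r)$ be a $G_K$-invariant disk and let $\beta\in D\cap K_{\rm alg}$. If $r=\infty$, assume that $\beta$ is separable over $K$. Then there exists $\alpha\in D\cap K_{\rm alg}$ such that all of the following hold: - $K(\alpha)/K$ is separable and weakly totally wildly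 ramified; - $\tilde K\subset\widetilde{K(\alpha)}\subset\widetilde{K(\beta)}$; - $v(K^\times)\subset v(K(\alpha)^\times)\subset v(K(\beta)^\times)$; - if $K$ has residue characteristic $0$, then $\alpha\in K$; - if $K$ has residue characteristic $p>0$, then $[K(\alpha):K]$ is a power of $p$ that divides $[K(\beta):K]$. -/

import Mathlib

open scoped NNReal WithZero IntermediateField

namespace RamifiedApproximation

/-- The additive valuation attached to an absolute value and a base `q > 1`:
`|x| = q ^ (-v x)`, and `v 0 = ∞`. If the absolute values of the nonzero elements of `K` are
exactly the integral powers of `q`, this is the valuation with `v (Kˣ) = ℤ`; on an extension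
of `K` it is the extension of that valuation. -/
noncomputable def val {F : Type*} [NormedField F] (q : ℝ) (x : F) : WithTop ℝ :=
  open Classical in if x = 0 then ⊤ else ((-Real.logb q ‖x‖ : ℝ) : WithTop ℝ)

/-- The disk `D(a, r) = {b | v (b - a) ≥ r}`, with `r` in `ℝ ∪ {∞}`. -/
def disk {F : Type*} [NormedField F] (q : ℝ) (a : F) (r : WithTop ℝ) : Set F :=
  {b | r ≤ val q (b - a)}

section Fields

variable {K Kalg : Type*} [NontriviallyNormedField K] [NormedField Kalg] [NormedAlgebra K Kalg]

/-- The value group `v (Lˣ)` of an intermediate field, as a subgroup of `ℝ`. -/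
noncomputable def valueGroup (q : ℝ) (L : IntermediateField K Kalg) : AddSubgroup ℝ where
  carrier := {s | ∃ x ∈ L, x ≠ 0 ∧ val q x = (s : WithTop ℝ)}
  zero_mem' := ⟨1, one_mem L, one_ne_zero, by simp [val]⟩
  add_mem' := by
    rintro s t ⟨x, hx, hx0, hs⟩ ⟨y, hy, hy0, ht⟩
    refine ⟨x * y, mul_mem hx hy, mul_ne_zero hx0 hy0, ?_⟩
    rw [WithTop.coe_add, ← hs, ← ht]
    simp only [val, hx0, hy0, mul_eq_zero, or_self, if_false, norm_mul, ← WithTop.coe_add]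
    rw [Real.logb_mul (norm_ne_zero_iff.mpr hx0) (norm_ne_zero_iff.mpr hy0), neg_add]
  neg_mem' := by
    rintro s ⟨x, hx, hx0, hs⟩
    refine ⟨x⁻¹, inv_mem hx, inv_ne_zero hx0, ?_⟩
    simp only [val, hx0, if_false, WithTop.coe_inj] at hs
    simp only [val, inv_ne_zero hx0, if_false, norm_inv, Real.logb_inv, ← hs]

/-- The ramification index `e(L/K) = [v (Lˣ) : v (Kˣ)]`
(with the value `0` if this index is infinite). -/
noncomputable def ramificationIndex (q : ℝ) (L : IntermediateField K Kalg) : ℕ :=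
  (valueGroup q (⊥ : IntermediateField K Kalg)).relIndex (valueGroup q L)

/-- The map `ℂ_K → ℂ_K` induced by `σ ∈ Aut(K_alg / K)`: its extension by continuity to the
completion `ℂ_K` of `K_alg`. -/
noncomputable def galAct (σ : Kalg ≃ₐ[K] Kalg) :
    UniformSpace.Completion Kalg → UniformSpace.Completion Kalg :=
  UniformSpace.Completion.map σ

/-- Elements of `Aut(K_alg / K)` preserve the absolute value. -/
theorem norm_algEquiv [CompleteSpace K] [IsUltrametricDist K] [Algebra.IsAlgebraic K Kalg]
    (σ : Kalg ≃ₐ[K] Kalg) (x : Kalg) : ‖σ x‖ = ‖x‖ := by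
  rw [NormedAlgebra.norm_eq_spectralNorm K, NormedAlgebra.norm_eq_spectralNorm K x,
    spectralNorm, spectralNorm, minpoly.algEquiv_eq]

/-- On `K_alg` the map `galAct σ` is `σ` itself. -/
theorem galAct_coe [CompleteSpace K] [IsUltrametricDist K] [Algebra.IsAlgebraic K Kalg]
    (σ : Kalg ≃ₐ[K] Kalg) (x : Kalg) :
    galAct σ (x : UniformSpace.Completion Kalg) = ((σ x : Kalg) : UniformSpace.Completion Kalg) :=
  UniformSpace.Completion.map_coe
    (AddMonoidHomClass.isometry_of_norm σ (norm_algEquiv σ)).uniformContinuous x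

variable [IsUltrametricDist K] [IsUltrametricDist Kalg]

instance : (NormedField.valuation (K := K)).HasExtension (NormedField.valuation (K := Kalg)) where
  val_isEquiv_comap := by
    intro x y
    simp [NormedField.valuation_apply, ← NNReal.coe_le_coe]

/-- The residue field: the valuation ring modulo its maximal ideal. -/
abbrev Residue (F : Type*) [NormedField F] [IsUltrametricDist F] : Type _ :=
  IsLocalRing.ResidueField (NormedField.valuation (K := F)).valuationSubring

/-- The residue field of an intermediate field `L`, as an extension of the residue field of `K`
inside the residue field of `K_alg`: the set of all reductions of integral elements of `L`. -/
noncomputable def residueField (L : IntermediateField K Kalg) :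
    IntermediateField (Residue K) (Residue Kalg) where
  carrier := {t | ∃ x : (NormedField.valuation (K := Kalg)).valuationSubring,
    (x : Kalg) ∈ L ∧ IsLocalRing.residue _ x = t}
  mul_mem' := by
    rintro _ _ ⟨x, hx, rfl⟩ ⟨y, hy, rfl⟩
    exact ⟨x * y, mul_mem hx hy, map_mul _ _ _⟩
  add_mem' := by
    rintro _ _ ⟨x, hx, rfl⟩ ⟨y, hy, rfl⟩
    exact ⟨x + y, add_mem hx hy, map_add _ _ _⟩
  algebraMap_mem' := by
    intro t
    obtain ⟨x, rfl⟩ := IsLocalRing.residue_surjective t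
    exact ⟨algebraMap _ _ x, L.algebraMap_mem _, rfl⟩
  inv_mem' := by
    rintro _ ⟨x, hx, rfl⟩
    by_cases h : IsUnit x
    · obtain ⟨u, rfl⟩ := h
      refine ⟨(u⁻¹ : Units _), ?_, ?_⟩
      · have : (((u⁻¹ : Units _) : (NormedField.valuation (K := Kalg)).valuationSubring) : Kalg)
            = ((u : (NormedField.valuation (K := Kalg)).valuationSubring) : Kalg)⁻¹ := by
          exact eq_inv_of_mul_eq_one_left (congrArg Subtype.val u.inv_mul)
        rw [this]
        exact inv_mem hx
      · exact eq_inv_of_mul_eq_one_left (by rw [← map_mul, u.inv_mul, map_one])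
    · have h0 : IsLocalRing.residue _ x = 0 := by
        rw [IsLocalRing.residue_eq_zero_iff]
        exact h
      refine ⟨0, zero_mem L, ?_⟩
      rw [h0, inv_zero, map_zero]

/-- A finite extension `L/K` is weakly totally ramified if its residue extension is purely
inseparable. -/
def IsWeaklyTotallyRamified (L : IntermediateField K Kalg) : Prop :=
  FiniteDimensional K L ∧ IsPurelyInseparable (Residue K) (residueField L)

/-- A finite extension `L/K` is weakly totally wildly ramified if it is weakly totally ramified
and its ramification index is a power of the residue characteristic of `K`. In residue
characteristic `0` the convention `0 ^ 0 = 1` is in force, so that the ramification index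
is then `1`. -/
def IsWeaklyTotallyWildlyRamified (q : ℝ) (L : IntermediateField K Kalg) : Prop :=
  IsWeaklyTotallyRamified L ∧ ∃ m : ℕ, ramificationIndex q L = ringChar (Residue K) ^ m

end Fields

end RamifiedApproximation

/-! The element `α` is a separable element of least degree over `K` in the disk; every other
property follows from minimality.

Elements of small degree come from polynomials. A monic polynomial of degree `n` has all its roots
in the disk of radius `ρ` exactly when its Gauss norm there is at most `ρ ^ n`. By invariance this
bound holds for the minimal polynomial of any algebraic point of the disk. Operations that keep a
polynomial monic over `K` and preserve the bound thus produce new points. There are three of them. A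
small linear perturbation makes `α` separable (`IsInvariantDisk.exists_isSeparable`). A Hasse
derivative divided by a unit binomial coefficient lowers the degree
(`IsInvariantDisk.exists_natDegree_le`): degree `p ^ j * u` with `u` prime to `p` drops to `p ^ j`,
and residue characteristic `0` allows degree `1`. A weighted trace from an unramified subextension
`E` of `K(α)` replaces the degree over `K` by the degree over `E`
(`IsInvariantDisk.exists_natDegree_le_of_unramified`), so minimality forces `E = K` and the residue
extension is purely inseparable.

Conversely, a nonzero polynomial over `K` of degree below that of `α` has no root in the disk, hence
is constant there to first order. Evaluating at `β` instead of `α` therefore preserves absolute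
values and residues (`IsMinimalInDisk.exists_norm_sub_lt`). -/

namespace RamifiedApproximation

open Polynomial

/-! ### Gauss norms on a disk and the location of roots -/

section Bounded

variable {F : Type*} [NormedField F]

/-- The Gauss norm of `f` on the disk of radius `ρ` about `b` is at most `ρ ^ n`. -/
def IsDiskBounded (b : F) (ρ : ℝ) (n : ℕ) (f : F[X]) : Prop :=
  ∀ i, ‖(taylor b f).coeff i‖ * ρ ^ i ≤ ρ ^ n

variable {b : F} {ρ : ℝ} {n m : ℕ} {f g : F[X]}

theorem isDiskBounded_one : IsDiskBounded b ρ 0 1 := by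
  intro i
  rw [taylor_one, coeff_C]
  split_ifs with h
  · simp [h]
  · simp

theorem isDiskBounded_X_sub_C (hρ : 0 < ρ) {c : F} (hc : ‖c - b‖ ≤ ρ) :
    IsDiskBounded b ρ 1 (X - C c) := by
  intro i
  have h : taylor b (X - C c) = X + C (b - c) := by
    rw [map_sub, taylor_X, taylor_C, C_sub]; ring
  rw [h, coeff_add, coeff_X, coeff_C]
  rcases i with _ | _ | i
  · simpa [norm_sub_rev b c] using hc
  · simp
  · simp [hρ.le]

theorem IsDiskBounded.smul {c : F} (hc : ‖c‖ ≤ 1) (hρ : 0 < ρ) (hf : IsDiskBounded b ρ n f) :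
    IsDiskBounded b ρ n (c • f) := by
  intro i
  rw [map_smul, coeff_smul, smul_eq_mul, norm_mul, mul_assoc]
  exact (mul_le_of_le_one_left (by positivity) hc).trans (hf i)

variable [IsUltrametricDist F]

theorem IsDiskBounded.mul (hρ : 0 < ρ) (hf : IsDiskBounded b ρ n f) (hg : IsDiskBounded b ρ m g) :
    IsDiskBounded b ρ (n + m) (f * g) := by
  intro i
  rw [taylor_mul, coeff_mul, ← le_div_iff₀ (by positivity)]
  refine IsUltrametricDist.norm_sum_le_of_forall_le_of_nonneg (by positivity) fun x hx => ?_
  rw [le_div_iff₀ (by positivity), norm_mul, ← Finset.HasAntidiagonal.mem_antidiagonal.mp hx, pow_add, pow_add]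
  calc _ = (‖(taylor b f).coeff x.1‖ * ρ ^ x.1) * (‖(taylor b g).coeff x.2‖ * ρ ^ x.2) := by ring
    _ ≤ _ := mul_le_mul (hf _) (hg _) (by positivity) (by positivity)

theorem IsDiskBounded.sum {ι : Type*} {s : Finset ι} {f : ι → F[X]} (hρ : 0 < ρ)
    (hf : ∀ i ∈ s, IsDiskBounded b ρ n (f i)) : IsDiskBounded b ρ n (∑ i ∈ s, f i) := by
  intro i
  rw [map_sum, finsetSum_coeff, ← le_div_iff₀ (by positivity)]
  refine IsUltrametricDist.norm_sum_le_of_forall_le_of_nonneg (by positivity) fun x hx => ?_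
  rw [le_div_iff₀ (by positivity)]
  exact hf x hx i

theorem IsDiskBounded.add (hρ : 0 < ρ) (hf : IsDiskBounded b ρ n f) (hg : IsDiskBounded b ρ n g) :
    IsDiskBounded b ρ n (f + g) := by
  have := IsDiskBounded.sum (s := Finset.univ) (f := ![f, g]) (b := b) (n := n) hρ
    (by intro i _; fin_cases i <;> simpa)
  simpa using this

theorem IsDiskBounded.multiset_prod (hρ : 0 < ρ) (s : Multiset F) (hs : ∀ c ∈ s, ‖c - b‖ ≤ ρ) :
    IsDiskBounded b ρ s.card (s.map (X - C ·)).prod := by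
  induction s using Multiset.induction_on with
  | empty => simpa using isDiskBounded_one
  | cons c s ih =>
    rw [Multiset.map_cons, Multiset.prod_cons, Multiset.card_cons, add_comm]
    exact (isDiskBounded_X_sub_C hρ (hs c (by simp))).mul hρ
      (ih fun d hd => hs d (Multiset.mem_cons_of_mem hd))

/-- A monic polynomial all of whose roots lie in the disk is bounded on it. -/
theorem isDiskBounded_of_roots [IsAlgClosed F] (hρ : 0 < ρ) (hf : f.Monic)
    (h : ∀ c, f.IsRoot c → ‖c - b‖ ≤ ρ) : IsDiskBounded b ρ f.natDegree f := by
  have hs := IsAlgClosed.splits f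
  have := IsDiskBounded.multiset_prod (b := b) hρ f.roots fun c hc => h c (isRoot_of_mem_roots hc)
  rwa [← hs.eq_prod_roots_of_monic hf, ← hs.natDegree_eq_card_roots] at this

/-- All the roots of a monic polynomial that is bounded on the disk lie in the disk. -/
theorem IsDiskBounded.norm_root_sub_le (hρ : 0 < ρ) (hf : IsDiskBounded b ρ f.natDegree f)
    (hm : f.Monic) {c : F} (hc : f.IsRoot c) : ‖c - b‖ ≤ ρ := by
  by_contra! hlt
  set y := c - b
  have hy : 0 < ‖y‖ := hρ.trans hlt
  have hroot : (taylor b f).eval y = 0 := by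
    rw [taylor_eval, sub_add_cancel]; exact hc
  have hdeg : (taylor b f).natDegree = f.natDegree := natDegree_taylor f b
  -- The leading term `y ^ n` is minus the sum of the lower ones, so some lower term has norm at
  -- least `‖y‖ ^ n`. The Gauss bound limits its coefficient to `ρ ^ (n - i)`, which is too small
  -- when `ρ < ‖y‖`.
  rw [eval_eq_sum_range, Finset.sum_range_succ, hdeg, add_eq_zero_iff_neg_eq] at hroot
  have hlead : (taylor b f).coeff f.natDegree = 1 := by
    rw [← hdeg, coeff_natDegree, leadingCoeff_taylor, hm.leadingCoeff]
  rw [hlead, one_mul] at hroot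
  have hn : ‖y‖ ^ f.natDegree = ‖∑ i ∈ Finset.range f.natDegree, (taylor b f).coeff i * y ^ i‖ := by
    rw [← norm_pow, ← hroot, norm_neg]
  rcases Nat.eq_zero_or_pos f.natDegree with h0 | h0
  · rw [hm.natDegree_eq_zero.mp h0] at hc
    simp at hc
  obtain ⟨i, hi, hle⟩ := IsUltrametricDist.exists_norm_finsetSum_le_of_nonempty
    (Finset.nonempty_range_iff.mpr h0.ne') (fun i => (taylor b f).coeff i * y ^ i)
  rw [← hn, norm_mul, norm_pow] at hle
  have hi' : i < f.natDegree := Finset.mem_range.mp hi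
  obtain ⟨k, hk⟩ := Nat.exists_eq_add_of_lt hi'
  have h1 := hf i
  have h2 : f.natDegree = i + (k + 1) := by omega
  rw [h2, pow_add, mul_comm] at h1
  rw [h2, pow_add, mul_comm] at hle
  have h3 := le_of_mul_le_mul_left h1 (pow_pos hρ i)
  have h4 := le_of_mul_le_mul_right hle (pow_pos hy i)
  exact absurd (h4.trans h3) (not_le.mpr (pow_lt_pow_left₀ hlt hρ.le (by omega)))

/-- Composing Hasse derivatives only introduces binomial coefficients, which are integers and so
have norm at most `1`. Iterated ordinary derivatives would bring in a factor `k!`, which need not be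
a unit. -/
theorem IsDiskBounded.hasseDeriv {k : ℕ} (hρ : 0 < ρ) (hf : IsDiskBounded b ρ (n + k) f) :
    IsDiskBounded b ρ n (hasseDeriv k f) := by
  intro i
  have h := congrArg (fun D => (D f).eval b) (hasseDeriv_comp (R := F) i k)
  simp only [LinearMap.comp_apply, LinearMap.smul_apply, eval_smul] at h
  rw [nsmul_eq_mul] at h
  rw [taylor_coeff, h, norm_mul, ← taylor_coeff, mul_assoc]
  refine (mul_le_of_le_one_left (by positivity)
    (IsUltrametricDist.norm_natCast_le_one F _)).trans ?_
  have := hf (i + k)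
  rw [pow_add, pow_add, ← mul_assoc] at this
  exact le_of_mul_le_mul_right this (by positivity)

end Bounded

/-! ### Polynomials without roots in a disk -/

section Perturbation

variable {F : Type*} [NormedField F] [IsUltrametricDist F]

theorem norm_eq_of_norm_sub_lt {x y : F} (h : ‖x - y‖ < ‖y‖) : ‖x‖ = ‖y‖ := by
  have := IsUltrametricDist.norm_add_eq_max_of_norm_ne_norm (x := x - y) (y := y) h.ne
  rwa [sub_add_cancel, max_eq_right h.le] at this

/-- A polynomial without roots in a disk is constant on it to first order. -/
theorem norm_eval_sub_eval_lt [IsAlgClosed F] {ρ : ℝ} {a c : F} (hac : ‖c - a‖ ≤ ρ) {g : F[X]}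
    (hg : g ≠ 0) (hroots : ∀ δ, g.IsRoot δ → ρ < ‖δ - a‖) :
    ‖g.eval c - g.eval a‖ < ‖g.eval a‖ := by
  -- For each root `d` outside the disk, `(c - d) / (a - d)` differs from `1` by less than `1` in
  -- norm, and this property is stable under products.
  have key : ∀ s : Multiset F, (∀ δ ∈ s, ρ < ‖δ - a‖) →
      ‖(s.map (c - ·)).prod - (s.map (a - ·)).prod‖ < ‖(s.map (a - ·)).prod‖ := by
    intro s hs
    induction s using Multiset.induction_on with
    | empty => simp
    | cons d s ih =>
      simp only [Multiset.map_cons, Multiset.prod_cons]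
      have h1 := ih fun δ hδ => hs δ (Multiset.mem_cons_of_mem hδ)
      have h2 : ‖c - a‖ < ‖a - d‖ := by
        rw [norm_sub_rev a d]; exact hac.trans_lt (hs d (by simp))
      have h3 := norm_eq_of_norm_sub_lt h1
      set P := (s.map (c - ·)).prod
      set Q := (s.map (a - ·)).prod
      have hQ : 0 < ‖Q‖ := (norm_nonneg _).trans_lt h1
      have h4 : (c - d) * P - (a - d) * Q = (c - a) * P + (a - d) * (P - Q) := by ring
      rw [h4]
      refine (IsUltrametricDist.norm_add_le_max _ _).trans_lt (max_lt ?_ ?_)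
      · rw [norm_mul, norm_mul, h3]
        exact mul_lt_mul_of_pos_right h2 hQ
      · rw [norm_mul, norm_mul]
        exact mul_lt_mul_of_pos_left h1 ((norm_nonneg _).trans_lt h2)
  have hs := IsAlgClosed.splits g
  rw [hs.eval_eq_prod_roots, hs.eval_eq_prod_roots, ← mul_sub, norm_mul, norm_mul]
  exact mul_lt_mul_of_pos_left (key g.roots fun δ hδ => hroots δ (isRoot_of_mem_roots hδ))
    (norm_pos_iff.mpr (leadingCoeff_ne_zero.mpr hg))

end Perturbation

/-! ### Invariant disks and their elements of minimal degree -/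

section InvariantDisk

variable {K Kalg : Type*} [NontriviallyNormedField K] [NormedField Kalg] [NormedAlgebra K Kalg]

variable (K) in
/-- The disk of radius `ρ` about `β` is invariant under the automorphisms of `Kalg` over `K`. -/
def IsInvariantDisk (ρ : ℝ) (β : Kalg) : Prop :=
  ∀ σ : Kalg ≃ₐ[K] Kalg, ‖σ β - β‖ ≤ ρ

variable (K) in
/-- `α` lies in the disk of radius `ρ` about `β`, and its degree over `K` is the least possible
for elements of that disk. -/
structure IsMinimalInDisk (ρ : ℝ) (β α : Kalg) : Prop where
  mem : ‖α - β‖ ≤ ρ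
  natDegree_le : ∀ γ : Kalg, ‖γ - β‖ ≤ ρ → (minpoly K α).natDegree ≤ (minpoly K γ).natDegree

theorem exists_isMinimalInDisk {ρ : ℝ} (hρ : 0 < ρ) (β : Kalg) :
    ∃ α, IsMinimalInDisk K ρ β α := by
  obtain ⟨α, hα, hmin⟩ := exists_minimalFor_of_wellFoundedLT (fun γ : Kalg => ‖γ - β‖ ≤ ρ)
    (fun γ => (minpoly K γ).natDegree) ⟨β, by simpa using hρ.le⟩
  exact ⟨α, hα, fun γ hγ => (le_total _ _).elim id fun h => hmin hγ h⟩

theorem norm_algHom [IsUltrametricDist K] [CompleteSpace K] [Algebra.IsAlgebraic K Kalg]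
    {E : Type*} [Field E] [Algebra K E] [Algebra.IsAlgebraic K E]
    (σ τ : E →ₐ[K] Kalg) (x : E) : ‖σ x‖ = ‖τ x‖ := by
  rw [NormedAlgebra.norm_eq_spectralNorm K, NormedAlgebra.norm_eq_spectralNorm K (τ x),
    spectralNorm, spectralNorm, minpoly.algHom_eq σ σ.injective, minpoly.algHom_eq τ τ.injective]

variable [IsUltrametricDist Kalg]

/-- The disk may be centred at any of its points. -/
theorem norm_sub_le_iff_of_norm_sub_le {ρ : ℝ} {α β γ : Kalg} (h : ‖α - β‖ ≤ ρ) :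
    ‖γ - α‖ ≤ ρ ↔ ‖γ - β‖ ≤ ρ := by
  constructor <;> intro h'
  · rw [← sub_add_sub_cancel γ α β]
    exact (IsUltrametricDist.norm_add_le_max _ _).trans (max_le h' h)
  · rw [norm_sub_rev] at h
    rw [← sub_add_sub_cancel γ β α]
    exact (IsUltrametricDist.norm_add_le_max _ _).trans (max_le h' h)

/-- The source of all points of small degree: it suffices to exhibit a monic polynomial over `K` of
that degree satisfying the Gauss bound. -/
theorem exists_root_mem_disk [IsAlgClosed Kalg] {ρ : ℝ} {β : Kalg} (hρ : 0 < ρ) {f : K[X]} (hf : f.Monic) (h0 : 0 < f.natDegree)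
    (hb : IsDiskBounded β ρ f.natDegree (f.map (algebraMap K Kalg))) :
    ∃ γ : Kalg, ‖γ - β‖ ≤ ρ ∧ aeval γ f = 0 ∧ (minpoly K γ).natDegree ≤ f.natDegree := by
  obtain ⟨γ, hγ⟩ := IsAlgClosed.exists_aeval_eq_zero Kalg f
    (natDegree_pos_iff_degree_pos.mp h0).ne'
  refine ⟨γ, ?_, hγ, natDegree_le_natDegree (minpoly.min K γ hf hγ)⟩
  refine IsDiskBounded.norm_root_sub_le hρ ?_ (hf.map _) (by rwa [IsRoot, eval_map_algebraMap])
  rwa [natDegree_map]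

variable [IsUltrametricDist K] [CompleteSpace K] [Normal K Kalg] {ρ : ℝ} {β : Kalg}

theorem IsInvariantDisk.norm_sub_le_of_isConjRoot (h : IsInvariantDisk K ρ β) {γ γ' : Kalg}
    (hγ : ‖γ - β‖ ≤ ρ) (hc : IsConjRoot K γ γ') : ‖γ' - β‖ ≤ ρ := by
  obtain ⟨σ, rfl⟩ := isConjRoot_iff_exists_algEquiv.mp hc.symm
  rw [← sub_add_sub_cancel _ (σ β) β, ← map_sub]
  refine (IsUltrametricDist.norm_add_le_max _ _).trans (max_le ?_ (h σ))
  rwa [norm_algEquiv]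

variable [IsAlgClosed Kalg]

/-- Invariance puts all conjugates of `γ`, that is all roots of its minimal polynomial, in the disk.
-/
theorem IsInvariantDisk.isDiskBounded_minpoly (h : IsInvariantDisk K ρ β) (hρ : 0 < ρ) {γ : Kalg}
    (hγ : ‖γ - β‖ ≤ ρ) :
    IsDiskBounded β ρ (minpoly K γ).natDegree ((minpoly K γ).map (algebraMap K Kalg)) := by
  have hint : IsIntegral K γ := Algebra.IsIntegral.isIntegral γ
  rw [← natDegree_map (algebraMap K Kalg)]
  refine isDiskBounded_of_roots hρ ((minpoly.monic hint).map _) fun c hc => ?_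
  refine h.norm_sub_le_of_isConjRoot hγ ?_
  rw [isConjRoot_iff_aeval_eq_zero hint]
  rwa [IsRoot, eval_map_algebraMap] at hc

theorem hasseDeriv_map' {R S : Type*} [CommSemiring R] [CommSemiring S] (φ : R →+* S) (k : ℕ)
    (f : R[X]) : hasseDeriv k (f.map φ) = (hasseDeriv k f).map φ := by
  ext i
  simp [hasseDeriv_coeff]

/-- An invariant disk containing an element of degree `N` contains one of degree at most `k` if the
binomial coefficient `N.choose k` is a unit. -/
theorem IsInvariantDisk.exists_natDegree_le (h : IsInvariantDisk K ρ β) (hρ : 0 < ρ) {γ : Kalg}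
    (hγ : ‖γ - β‖ ≤ ρ) {k : ℕ} (hk : 0 < k) (hkN : k ≤ (minpoly K γ).natDegree)
    (hc : ‖((minpoly K γ).natDegree.choose k : K)‖ = 1) :
    ∃ γ' : Kalg, ‖γ' - β‖ ≤ ρ ∧ (minpoly K γ').natDegree ≤ k := by
  have hint : IsIntegral K γ := Algebra.IsIntegral.isIntegral γ
  set f := minpoly K γ
  set N := f.natDegree with hN
  set c : K := (N.choose k : K)
  have hc0 : c ≠ 0 := by intro h0; rw [h0, norm_zero] at hc; exact zero_ne_one hc
  -- The Hasse derivative of order `N - k` has degree at most `k`, and the monic leading term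
  -- contributes `N.choose (N - k) = N.choose k` in degree `k`.
  have hcoeff : (hasseDeriv (N - k) f).coeff k = c := by
    rw [hasseDeriv_coeff, Nat.add_sub_cancel' hkN, hN, (minpoly.monic hint).coeff_natDegree,
      mul_one, ← hN, Nat.choose_symm hkN]
  have hmonic : (c⁻¹ • hasseDeriv (N - k) f).Monic ∧
      (c⁻¹ • hasseDeriv (N - k) f).natDegree = k := by
    have h1 : (c⁻¹ • hasseDeriv (N - k) f).natDegree ≤ k := by
      refine (natDegree_smul_le _ _).trans ((natDegree_hasseDeriv_le _ _).trans ?_)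
      omega
    have h2 : (c⁻¹ • hasseDeriv (N - k) f).coeff k = 1 := by
      rw [coeff_smul, hcoeff, smul_eq_mul, inv_mul_cancel₀ hc0]
    exact ⟨monic_of_natDegree_le_of_coeff_eq_one k h1 h2,
      natDegree_eq_of_le_of_coeff_ne_zero h1 (by rw [h2]; exact one_ne_zero)⟩
  obtain ⟨γ', h1, -, h2⟩ := exists_root_mem_disk (β := β) hρ hmonic.1 (by rw [hmonic.2]; exact hk)
    (by
      rw [hmonic.2, Polynomial.map_smul, ← hasseDeriv_map']
      refine IsDiskBounded.smul (by simp [norm_inv, hc]) hρ (IsDiskBounded.hasseDeriv hρ ?_)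
      rw [Nat.add_sub_cancel' hkN]
      exact h.isDiskBounded_minpoly hρ hγ)
  exact ⟨γ', h1, h2.trans_eq hmonic.2⟩

/-- An invariant disk contains a separable element of minimal degree. -/
theorem IsInvariantDisk.exists_isSeparable (h : IsInvariantDisk K ρ β) (hρ : 0 < ρ) :
    ∃ α, IsMinimalInDisk K ρ β α ∧ IsSeparable K α := by
  obtain ⟨α, hα⟩ := exists_isMinimalInDisk (K := K) hρ β
  have hint : IsIntegral K α := Algebra.IsIntegral.isIntegral α
  by_cases hsep : IsSeparable K α
  · exact ⟨α, hα, hsep⟩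
  set f := minpoly K α with hf
  have hmonic : f.Monic := minpoly.monic hint
  have hder : derivative f = 0 := by
    by_contra hne
    exact hsep ((separable_iff_derivative_ne_zero (minpoly.irreducible hint)).mpr hne)
  have hdeg : 1 < f.natDegree := by
    have hpos := minpoly.natDegree_pos hint
    by_contra! hle
    have h1 : f.natDegree = 1 := le_antisymm hle hpos
    have := hmonic.coeff_natDegree
    have h2 := congrArg (fun g => coeff g 0) hder
    simp only [coeff_derivative, coeff_zero] at h2
    rw [h1] at this
    simp [this] at h2
  -- The polynomial `f + ε X` has derivative `ε`, hence is separable. The Taylor coefficients of `ε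
  -- X` at `β` are `ε β` and `ε`; the two bounds on `ε` keep the Gauss norm within `ρ ^ n`.
  obtain ⟨ε, hε0, hε⟩ := NormedField.exists_norm_lt K
    (r := min (ρ ^ f.natDegree / ρ) (ρ ^ f.natDegree / (‖β‖ + 1))) (by positivity)
  rw [lt_min_iff, lt_div_iff₀ hρ, lt_div_iff₀ (by positivity)] at hε
  have hltdeg : (C ε * X).degree < f.degree := by
    refine (degree_C_mul_X_le ε).trans_lt ?_
    rw [degree_eq_natDegree hmonic.ne_zero]
    exact_mod_cast hdeg
  have hnat : (f + C ε * X).natDegree = f.natDegree :=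
    natDegree_eq_of_degree_eq (degree_add_eq_left_of_degree_lt hltdeg)
  have hmonic' : (f + C ε * X).Monic := hmonic.add_of_left hltdeg
  obtain ⟨α', hα', hroot, hle⟩ := exists_root_mem_disk (β := β) hρ hmonic' (by omega) (by
    rw [hnat, Polynomial.map_add]
    refine (h.isDiskBounded_minpoly hρ hα.mem).add hρ fun i => ?_
    rw [Polynomial.map_mul, map_C, map_X, taylor_mul, taylor_C, taylor_X, mul_add, ← C_mul,
      coeff_add, coeff_C_mul_X, coeff_C]
    rcases i with _ | _ | i
    · simp only [pow_zero, mul_one]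
      simp
      nlinarith [norm_nonneg ε]
    · simpa [norm_algebraMap'] using hε.1.le
    · simpa using by positivity)
  have hmin : IsMinimalInDisk K ρ β α' :=
    ⟨hα', fun γ hγ => (hle.trans_eq hnat).trans (hα.natDegree_le γ hγ)⟩
  -- Minimality of the degree makes the perturbed polynomial irreducible.
  have heq : minpoly K α' = f + C ε * X := by
    have hint' : IsIntegral K α' := Algebra.IsIntegral.isIntegral α'
    refine (eq_of_monic_of_dvd_of_natDegree_le (minpoly.monic hint') hmonic'
      (minpoly.dvd K α' hroot) ?_).symm
    rw [hnat]
    exact hα.natDegree_le α' hα'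
  refine ⟨α', hmin, ?_⟩
  rw [IsSeparable, heq, separable_def, derivative_add, hder, zero_add, derivative_C_mul,
    derivative_X, mul_one]
  exact ⟨0, C ε⁻¹, by simp [← C_mul, norm_pos_iff.mp hε0]⟩

end InvariantDisk

/-! ### Residues and lifting of separable residue classes -/

section ResidueExtension

/-- The valuation ring of a nonarchimedean normed field. -/
noncomputable abbrev Integers (F : Type*) [NormedField F] [IsUltrametricDist F] : ValuationSubring F :=
  (NormedField.valuation (K := F)).valuationSubring

theorem mem_integers {F : Type*} [NormedField F] [IsUltrametricDist F] {x : F} :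
    x ∈ Integers F ↔ ‖x‖ ≤ 1 := by
  rw [Valuation.mem_valuationSubring_iff, NormedField.valuation_apply, ← NNReal.coe_le_coe]
  simp

theorem residue_eq_zero_iff_norm {F : Type*} [NormedField F] [IsUltrametricDist F]
    (x : Integers F) : IsLocalRing.residue _ x = 0 ↔ ‖(x : F)‖ < 1 := by
  rw [IsLocalRing.residue_eq_zero_iff, Valuation.mem_maximalIdeal_iff, NormedField.valuation_apply,
    ← NNReal.coe_lt_coe]
  simp

theorem norm_le_one_of_norm_sub_lt {F : Type*} [NormedField F] [IsUltrametricDist F] {x y : F}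
    (hx : ‖x‖ ≤ 1) (h : ‖x - y‖ < 1) : ‖y‖ ≤ 1 := by
  rw [norm_sub_rev] at h
  rw [← sub_add_cancel y x]
  exact (IsUltrametricDist.norm_add_le_max _ _).trans (max_le h.le hx)

variable {K Kalg : Type*} [NontriviallyNormedField K] [NormedField Kalg] [NormedAlgebra K Kalg]
  [IsUltrametricDist K] [IsUltrametricDist Kalg]

theorem residue_aeval (f : (Integers K)[X]) (x : Integers Kalg) :
    IsLocalRing.residue _ (aeval x f) =
      aeval (IsLocalRing.residue _ x) (f.map (IsLocalRing.residue (Integers K))) := by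
  rw [aeval_def, hom_eval₂, aeval_def, eval₂_map]
  rfl

theorem coe_aeval_integers (f : (Integers K)[X]) (x : Integers Kalg) :
    ((aeval x f : Integers Kalg) : Kalg) =
      aeval (x : Kalg) (f.map (algebraMap (Integers K) K)) := by
  rw [aeval_def, aeval_def, eval₂_map]
  exact hom_eval₂ f _ (algebraMap (Integers Kalg) Kalg) x

variable [CompleteSpace K] [Normal K Kalg] [IsAlgClosed Kalg]

/-- The unit disk about `0` is invariant, and its Gauss bound says that the coefficients are
integral. -/
theorem exists_map_eq_minpoly (x : Integers Kalg) :
    ∃ f : (Integers K)[X], f.Monic ∧ f.map (algebraMap (Integers K) K) = minpoly K (x : Kalg) := by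
  have hint : IsIntegral K (x : Kalg) := Algebra.IsIntegral.isIntegral _
  have hb := IsInvariantDisk.isDiskBounded_minpoly (K := K) (β := (0 : Kalg)) (ρ := 1)
    (fun σ => by simp) one_pos (γ := (x : Kalg)) (by simpa using mem_integers.mp x.2)
  have hl : minpoly K (x : Kalg) ∈ lifts (algebraMap (Integers K) K) := by
    rw [lifts_iff_coeff_lifts]
    intro i
    have := hb i
    rw [taylor_zero, coeff_map, norm_algebraMap', one_pow, one_pow, mul_one] at this
    exact ⟨⟨_, mem_integers.mpr this⟩, rfl⟩
  obtain ⟨f, hf, -, hm⟩ := lifts_and_natDegree_eq_and_monic hl (minpoly.monic hint)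
  exact ⟨f, hm, hf⟩

theorem isIntegral_residue (x : Integers Kalg) :
    IsIntegral (Residue K) (IsLocalRing.residue _ x : Residue Kalg) := by
  obtain ⟨f, hm, hf⟩ := exists_map_eq_minpoly (K := K) x
  refine ⟨_, hm.map (IsLocalRing.residue _), ?_⟩
  rw [← aeval_def, ← residue_aeval]
  have : aeval x f = 0 := by
    apply Subtype.ext
    rw [coe_aeval_integers, hf, minpoly.aeval]
    rfl
  rw [this, map_zero]

/-- The degree of an integral element is at least that of its residue. -/
theorem natDegree_minpoly_residue_le (x : Integers Kalg) :
    (minpoly (Residue K) (IsLocalRing.residue _ x : Residue Kalg)).natDegree ≤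
      (minpoly K (x : Kalg)).natDegree := by
  obtain ⟨f, hm, hf⟩ := exists_map_eq_minpoly (K := K) x
  have h0 : aeval x f = 0 := by
    apply Subtype.ext
    rw [coe_aeval_integers, hf, minpoly.aeval]
    rfl
  rw [← hf, hm.natDegree_map, ← hm.natDegree_map (IsLocalRing.residue (Integers K))]
  refine natDegree_le_natDegree (minpoly.min _ _ (hm.map _) ?_)
  rw [← residue_aeval, h0, map_zero]

theorem exists_norm_sub_lt_one_of_prod {F : Type*} [NormedField F] (s : Multiset F)
    (x : F) (h : ‖(s.map (x - ·)).prod‖ < 1) : ∃ y ∈ s, ‖x - y‖ < 1 := by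
  induction s using Multiset.induction_on with
  | empty => simp at h
  | cons a s ih =>
    by_cases ha : ‖x - a‖ < 1
    · exact ⟨a, by simp, ha⟩
    · rw [Multiset.map_cons, Multiset.prod_cons, norm_mul] at h
      obtain ⟨y, hy, hlt⟩ := ih
        ((le_mul_of_one_le_left (norm_nonneg _) (not_lt.mp ha)).trans_lt h)
      exact ⟨y, Multiset.mem_cons_of_mem hy, hlt⟩

/-- A separable residue class of `K(x)` lifts to an unramified generator inside `K(x)`. -/
theorem exists_unramified_lift (x : Integers Kalg)
    (hsep : IsSeparable (Residue K) (IsLocalRing.residue _ x : Residue Kalg)) :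
    ∃ τ : Kalg, τ ∈ K⟮(x : Kalg)⟯ ∧ ‖τ‖ ≤ 1 ∧ IsSeparable K τ ∧
      ‖aeval τ (derivative (minpoly K τ))‖ = 1 ∧ (minpoly K τ).natDegree =
        (minpoly (Residue K) (IsLocalRing.residue _ x : Residue Kalg)).natDegree := by
  set t : Residue Kalg := IsLocalRing.residue _ x with ht
  have hint : IsIntegral (Residue K) t := isIntegral_residue x
  -- A monic lift of the minimal polynomial of `t` takes a value of norm less than `1` at `x`, so
  -- one of its roots `τ` is at distance less than `1` from `x`.
  obtain ⟨f, hf, hdeg, hm⟩ := lifts_and_natDegree_eq_and_monic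
    ((mem_lifts _).mpr (map_surjective _ IsLocalRing.residue_surjective (minpoly (Residue K) t)))
    (minpoly.monic hint)
  set F : K[X] := f.map (algebraMap (Integers K) K) with hF
  have hFm : F.Monic := hm.map _
  have hxF : ‖aeval (x : Kalg) F‖ < 1 := by
    rw [← coe_aeval_integers, ← residue_eq_zero_iff_norm, residue_aeval, hf, minpoly.aeval]
  obtain ⟨τ, hτroot, hτ⟩ : ∃ τ : Kalg, aeval τ F = 0 ∧ ‖(x : Kalg) - τ‖ < 1 := by
    rw [← eval_map_algebraMap, (IsAlgClosed.splits _).eval_eq_prod_roots_of_monic (hFm.map _)]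
      at hxF
    obtain ⟨τ, h1, h2⟩ := exists_norm_sub_lt_one_of_prod _ _ hxF
    refine ⟨τ, ?_, h2⟩
    rw [← eval_map_algebraMap]
    exact isRoot_of_mem_roots h1
  have hτ1 : ‖τ‖ ≤ 1 := norm_le_one_of_norm_sub_lt (mem_integers.mp x.2) hτ
  set τ' : Integers Kalg := ⟨τ, mem_integers.mpr hτ1⟩ with hτ'
  have hres : IsLocalRing.residue _ τ' = t := by
    rw [ht, eq_comm, ← sub_eq_zero, ← map_sub, residue_eq_zero_iff_norm]
    exact hτ
  have hτint : IsIntegral K τ := Algebra.IsIntegral.isIntegral _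
  -- The degree of `τ` is at least that of its residue `t`, which is the degree of `F`.
  have hFmin : F = minpoly K τ := by
    refine eq_of_monic_of_dvd_of_natDegree_le (minpoly.monic hτint) hFm
      (minpoly.dvd K τ hτroot) ?_
    rw [hF, hm.natDegree_map, hdeg, ← hres]
    exact natDegree_minpoly_residue_le τ'
  have hder : ‖aeval τ (derivative F)‖ = 1 := by
    have h1 : aeval τ (derivative F) = ((aeval τ' (derivative f) : Integers Kalg) : Kalg) := by
      rw [coe_aeval_integers, hF, derivative_map]
    rw [h1]
    refine le_antisymm (mem_integers.mp (Subtype.mem _)) (not_lt.mp fun hlt => ?_)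
    rw [← residue_eq_zero_iff_norm, residue_aeval, hres, ← derivative_map, hf] at hlt
    exact hsep.aeval_derivative_ne_zero (minpoly.aeval _ _) hlt
  have hτsep : IsSeparable K τ := by
    refine (separable_iff_derivative_ne_zero (minpoly.irreducible hτint)).mpr fun h0 => ?_
    rw [hFmin, h0, map_zero, norm_zero] at hder
    exact zero_ne_one hder
  refine ⟨τ, ?_, hτ1, hτsep, hFmin ▸ hder, ?_⟩
  -- Krasner's lemma applies because distinct conjugates of `τ` are at distance at least `1`, while
  -- `x` is nearer to `τ`.
  · have := IsKrasner.of_completeSpace_of_normal (K := K) (L := Kalg)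
    refine IsKrasner.krasner hτsep (IsAlgClosed.splits _) (Algebra.IsIntegral.isIntegral _)
      fun y hy hne => ?_
    rw [norm_sub_rev]
    refine hτ.trans_le (not_lt.mp fun hlt => ?_)
    have hy1 : ‖y‖ ≤ 1 := norm_le_one_of_norm_sub_lt hτ1 hlt
    set y' : Integers Kalg := ⟨y, mem_integers.mpr hy1⟩
    have hyF : aeval y' f = 0 := by
      apply Subtype.ext
      rw [coe_aeval_integers, ← hF, hFmin]
      exact hy.aeval_eq_zero
    have hτF : aeval τ' f = 0 := by
      apply Subtype.ext
      rw [coe_aeval_integers]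
      exact hτroot
    -- If a conjugate `y` has the same residue as `τ`, then `0 = (f'(τ) + k (y - τ)) (y - τ)`; the
    -- first factor is a unit because `f'(τ)` is, so `y = τ`.
    obtain ⟨k, hk⟩ := binomExpansion (f.map (algebraMap (Integers K) (Integers Kalg))) τ' (y' - τ')
    rw [add_sub_cancel, eval_map_algebraMap, eval_map_algebraMap, hyF, hτF, zero_add,
      derivative_map, eval_map_algebraMap, pow_two, ← mul_assoc, ← add_mul, eq_comm,
      mul_eq_zero] at hk
    rcases hk with hk | hk
    · have h2 : IsLocalRing.residue _ (y' - τ') = 0 := by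
        rw [residue_eq_zero_iff_norm]
        rw [norm_sub_rev] at hlt
        exact hlt
      have h3 := congrArg (IsLocalRing.residue _) hk
      rw [map_add, map_mul, h2, mul_zero, add_zero, map_zero, residue_eq_zero_iff_norm,
        coe_aeval_integers, ← derivative_map, ← hF] at h3
      exact h3.ne hder
    · exact hne (congrArg Subtype.val (sub_eq_zero.mp hk)).symm
  · rw [← hFmin, hF, hm.natDegree_map, hdeg]

end ResidueExtension

/-! ### Consequences of minimal degree for values and residues -/

section MinimalDegree

variable {K Kalg : Type*} [NontriviallyNormedField K] [NormedField Kalg] [NormedAlgebra K Kalg]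
  [IsUltrametricDist Kalg] [Normal K Kalg] [IsAlgClosed Kalg] {ρ : ℝ} {α β : Kalg}

/-- If `α` has minimal degree in a disk, every element of `K(α)` is approximated to first order by
elements of `K(γ)`, for all `γ` in the disk. -/
theorem IsMinimalInDisk.exists_norm_sub_lt (hα : IsMinimalInDisk K ρ β α) {γ : Kalg}
    (hγ : ‖γ - β‖ ≤ ρ) {x : Kalg} (hx : x ∈ K⟮α⟯) (hx0 : x ≠ 0) :
    ∃ y ∈ K⟮γ⟯, ‖y - x‖ < ‖x‖ := by
  have hαint : IsIntegral K α := Algebra.IsIntegral.isIntegral α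
  have hx' : x ∈ Algebra.adjoin K {α} := by
    rw [← IntermediateField.adjoin_simple_toSubalgebra_of_isAlgebraic hαint.isAlgebraic]
    exact hx
  obtain ⟨f, rfl⟩ := Algebra.adjoin_mem_exists_aeval K α hx'
  set g := f %ₘ minpoly K α with hg
  have hfg : aeval α g = aeval α f := minpoly.aeval_modByMonic_minpoly f α
  have hg0 : g ≠ 0 := by
    intro h0
    rw [← hfg, h0, map_zero] at hx0
    exact hx0 rfl
  refine ⟨aeval γ g, IntermediateField.algebra_adjoin_le_adjoin K {γ}
    (aeval_mem_adjoin_singleton K γ), ?_⟩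
  rw [← hfg, ← eval_map_algebraMap, ← eval_map_algebraMap]
  refine norm_eval_sub_eval_lt (ρ := ρ) ((norm_sub_le_iff_of_norm_sub_le hα.mem).mpr hγ)
    (by simpa using hg0) fun δ hδ => ?_
  by_contra! hle
  rw [norm_sub_le_iff_of_norm_sub_le hα.mem] at hle
  have h1 := hα.natDegree_le δ hle
  rw [IsRoot, eval_map_algebraMap] at hδ
  have h2 := natDegree_le_natDegree (minpoly.degree_le_of_ne_zero K δ hg0 hδ)
  have h3 : g.natDegree < (minpoly K α).natDegree :=
    natDegree_modByMonic_lt _ (minpoly.monic hαint) (minpoly.ne_one K α)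
  omega

theorem IsMinimalInDisk.valueGroup_le (q : ℝ) (hα : IsMinimalInDisk K ρ β α) {γ : Kalg}
    (hγ : ‖γ - β‖ ≤ ρ) : valueGroup q K⟮α⟯ ≤ valueGroup q K⟮γ⟯ := by
  rintro s ⟨x, hx, hx0, hs⟩
  obtain ⟨y, hy, hlt⟩ := hα.exists_norm_sub_lt hγ hx hx0
  have hxy := norm_eq_of_norm_sub_lt hlt
  have hy0 : y ≠ 0 := norm_ne_zero_iff.mp (hxy ▸ norm_ne_zero_iff.mpr hx0)
  refine ⟨y, hy, hy0, ?_⟩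
  rw [← hs]
  simp only [val, hx0, hy0, hxy, if_false]

variable [IsUltrametricDist K]

theorem IsMinimalInDisk.residueField_le (hα : IsMinimalInDisk K ρ β α) {γ : Kalg}
    (hγ : ‖γ - β‖ ≤ ρ) : residueField K⟮α⟯ ≤ residueField K⟮γ⟯ := by
  rintro _ ⟨x, hx, rfl⟩
  by_cases hx0 : (x : Kalg) = 0
  · rw [show x = 0 from Subtype.ext hx0, map_zero]
    exact zero_mem _
  obtain ⟨y, hy, hlt⟩ := hα.exists_norm_sub_lt hγ hx hx0
  have hx1 := mem_integers.mp x.2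
  refine ⟨⟨y, mem_integers.mpr ((norm_eq_of_norm_sub_lt hlt).trans_le hx1)⟩, hy, ?_⟩
  rw [← sub_eq_zero, ← map_sub, residue_eq_zero_iff_norm]
  exact hlt.trans_le hx1

variable [CompleteSpace K]

/-- Averaging over an unramified extension: if a generator `τ` of `E = K(τ)` has integral powers
and its different is trivial, then an invariant disk containing an element of degree `m` over `E`
contains an element of degree at most `m` over `K`. -/
theorem IsInvariantDisk.exists_natDegree_le_of_unramified (h : IsInvariantDisk K ρ β) (hρ : 0 < ρ)
    (hα : ‖α - β‖ ≤ ρ) {τ : Kalg} (hτ : ‖τ‖ ≤ 1) (hsep : IsSeparable K τ)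
    (hder : ‖aeval τ (derivative (minpoly K τ))‖ = 1) :
    ∃ γ : Kalg, ‖γ - β‖ ≤ ρ ∧ (minpoly K γ).natDegree ≤ (minpoly K⟮τ⟯ α).natDegree := by
  classical
  have hτint : IsIntegral K τ := Algebra.IsIntegral.isIntegral _
  have hαint : IsIntegral K⟮τ⟯ α := Algebra.IsIntegral.isIntegral _
  have : FiniteDimensional K K⟮τ⟯ := IntermediateField.adjoin.finiteDimensional hτint
  have : Algebra.IsSeparable K K⟮τ⟯ :=
    (IntermediateField.isSeparable_adjoin_simple_iff_isSeparable K Kalg).mpr hsep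
  set y : K⟮τ⟯ := IntermediateField.AdjoinSimple.gen K τ with hy
  set d := Module.finrank K K⟮τ⟯ with hd
  have hd0 : 0 < d := Module.finrank_pos
  have hytop : Algebra.adjoin K {y} = ⊤ := by
    have := (IntermediateField.adjoin.powerBasis hτint).adjoin_gen_eq_top
    rwa [IntermediateField.adjoin.powerBasis_gen] at this
  -- By Euler's formula this element has trace `1`. It is integral because the derivative has norm
  -- `1` at `τ`.
  set u : K⟮τ⟯ := y ^ (d - 1) / aeval y (derivative (minpoly K y)) with hu
  have hnorm (σ : K⟮τ⟯ →ₐ[K] Kalg) : ‖σ u‖ ≤ 1 := by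
    rw [norm_algHom σ K⟮τ⟯.val, hu, map_div₀, map_pow, ← aeval_algHom_apply, norm_div, norm_pow]
    have h1 : K⟮τ⟯.val y = τ := IntermediateField.AdjoinSimple.coe_gen K τ
    rw [h1, IntermediateField.minpoly_gen, hder, div_one]
    exact pow_le_one₀ (norm_nonneg _) hτ
  have hsum : ∑ σ : K⟮τ⟯ →ₐ[K] Kalg, σ u = 1 := by
    have h1 := sum_smul_minpolyDiv_eq_X_pow (K := K) Kalg hytop (r := d - 1) (by omega)
    have h2 := congrArg (fun p => coeff p (d - 1)) h1
    have h3 : (minpolyDiv K y).coeff (d - 1) = 1 := by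
      have h4 := (minpolyDiv_monic (Algebra.IsIntegral.isIntegral (R := K) y)).coeff_natDegree
      have h5 := natDegree_minpolyDiv_succ (Algebra.IsIntegral.isIntegral (R := K) y)
      rw [IntermediateField.minpoly_gen, ← IntermediateField.adjoin.finrank hτint, ← hd] at h5
      rwa [show d - 1 = (minpolyDiv K y).natDegree by omega]
    simpa [finsetSum_coeff, coeff_map, coeff_smul, h3, ← hu] using h2
  set g := minpoly K⟮τ⟯ α with hg
  have hgm : g.Monic := minpoly.monic hαint
  set m := g.natDegree with hm
  -- The trace of `u * g`, taken coefficientwise. It is defined over `K`, is monic of degree `m`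
  -- because `u` has trace `1`, and satisfies the Gauss bound because the roots of each conjugate of
  -- `g` are conjugates of `α` over `K`.
  set P : Kalg[X] := ∑ σ : K⟮τ⟯ →ₐ[K] Kalg, σ u • g.map (σ : K⟮τ⟯ →+* Kalg) with hP
  have hPcoeff (i : ℕ) : P.coeff i = algebraMap K Kalg (Algebra.trace K K⟮τ⟯ (u * g.coeff i)) := by
    rw [trace_eq_sum_embeddings Kalg, hP, finsetSum_coeff]
    simp
  have hPdeg : P.natDegree ≤ m := by
    refine natDegree_sum_le_of_forall_le _ _ fun σ _ => (natDegree_smul_le _ _).trans ?_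
    exact natDegree_map_le
  have hPm : P.coeff m = 1 := by
    rw [hP, finsetSum_coeff, ← hsum]
    refine Finset.sum_congr rfl fun σ _ => ?_
    rw [coeff_smul, coeff_map, hgm.coeff_natDegree, map_one, smul_eq_mul, mul_one]
  have hPmonic : P.Monic := monic_of_natDegree_le_of_coeff_eq_one m hPdeg hPm
  have hPnat : P.natDegree = m :=
    natDegree_eq_of_le_of_coeff_ne_zero hPdeg (by rw [hPm]; exact one_ne_zero)
  have hPb : IsDiskBounded β ρ m P := by
    refine IsDiskBounded.sum hρ fun σ _ => IsDiskBounded.smul (hnorm σ) hρ ?_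
    rw [hm, ← natDegree_map (σ : K⟮τ⟯ →+* Kalg)]
    refine isDiskBounded_of_roots hρ (hgm.map _) fun c hc => ?_
    refine h.norm_sub_le_of_isConjRoot hα ?_
    rw [isConjRoot_iff_aeval_eq_zero (Algebra.IsIntegral.isIntegral _)]
    obtain ⟨k, hk⟩ := minpoly.dvd_map_of_isScalarTower K K⟮τ⟯ α
    have h1 := congrArg (fun p => (p.map (σ : K⟮τ⟯ →+* Kalg)).eval c) hk
    simp only [Polynomial.map_mul, eval_mul] at h1
    rw [hc.eq_zero, zero_mul, Polynomial.map_map, AlgHom.comp_algebraMap] at h1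
    rwa [← eval_map_algebraMap]
  obtain ⟨H, hH, hHdeg, hHm⟩ := lifts_and_natDegree_eq_and_monic
    ((lifts_iff_coeff_lifts (f := algebraMap K Kalg) P).mpr fun i => ⟨_, (hPcoeff i).symm⟩) hPmonic
  obtain ⟨γ, h1, -, h2⟩ := exists_root_mem_disk (β := β) hρ hHm
    (by rw [hHdeg, hPnat]; exact minpoly.natDegree_pos hαint) (by rwa [hH, hHdeg, hPnat])
  exact ⟨γ, h1, h2.trans_eq (hHdeg.trans hPnat)⟩

/-- An element of minimal degree in an invariant disk generates a weakly totally ramified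
extension. -/
theorem IsMinimalInDisk.isWeaklyTotallyRamified (hα : IsMinimalInDisk K ρ β α)
    (h : IsInvariantDisk K ρ β) (hρ : 0 < ρ) : IsWeaklyTotallyRamified (K⟮α⟯) := by
  have hαint : IsIntegral K α := Algebra.IsIntegral.isIntegral α
  refine ⟨IntermediateField.adjoin.finiteDimensional hαint, ⟨⟨?_⟩, ?_⟩⟩
  · rintro ⟨_, x, -, rfl⟩
    rw [← isIntegral_algebraMap_iff (algebraMap (residueField K⟮α⟯) (Residue Kalg)).injective]
    exact isIntegral_residue x
  · rintro ⟨_, x, hx, rfl⟩ hsep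
    set t : residueField K⟮α⟯ := ⟨IsLocalRing.residue _ x, x, hx, rfl⟩ with ht
    have hmin : minpoly (Residue K) t =
        minpoly (Residue K) (IsLocalRing.residue _ x : Residue Kalg) :=
      (minpoly.algebraMap_eq (algebraMap (residueField K⟮α⟯) (Residue Kalg)).injective t).symm
    obtain ⟨τ, hτmem, hτ1, hτsep, hder, hdeg⟩ :=
      exists_unramified_lift (K := K) x (by rwa [IsSeparable, ← hmin])
    obtain ⟨γ, hγ, hle⟩ := h.exists_natDegree_le_of_unramified hρ hα.mem hτ1 hτsep hder
    have hτint : IsIntegral K τ := Algebra.IsIntegral.isIntegral _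
    have hαint' : IsIntegral K⟮τ⟯ α := Algebra.IsIntegral.isIntegral _
    have hτα : K⟮τ⟯ ≤ K⟮α⟯ := by
      rw [IntermediateField.adjoin_simple_le_iff]
      exact (IntermediateField.adjoin_simple_le_iff.mpr hx) hτmem
    have htower : (minpoly K τ).natDegree * (minpoly K⟮τ⟯ α).natDegree =
        (minpoly K α).natDegree := by
      rw [← IntermediateField.adjoin.finrank hτint, ← IntermediateField.adjoin.finrank hαint',
        ← IntermediateField.adjoin.finrank hαint, Module.finrank_mul_finrank]
      have : (K⟮τ⟯⟮α⟯).restrictScalars K = K⟮α⟯ := by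
        rw [IntermediateField.adjoin_simple_adjoin_simple]
        refine le_antisymm (IntermediateField.adjoin_le_iff.mpr ?_)
          (IntermediateField.adjoin.mono _ _ _ (by simp))
        rintro z (rfl | rfl)
        · exact hτα (IntermediateField.mem_adjoin_simple_self K z)
        · exact IntermediateField.mem_adjoin_simple_self K z
      rw [← this]
      rfl
    -- The averaged point `γ` has degree at most `[K(α) : K(τ)]`, whereas `α` has degree `[K(τ) :
    -- K]` times that; minimality leaves only `[K(τ) : K] = 1`.
    have hd1 : (minpoly K τ).natDegree = 1 := by
      have h1 := (hα.natDegree_le γ hγ).trans hle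
      have h2 := minpoly.natDegree_pos hαint'
      have h3 := minpoly.natDegree_pos hτint
      rw [← htower] at h1
      have := Nat.le_of_mul_le_mul_right (h1.trans_eq (one_mul _).symm) h2
      omega
    exact minpoly.natDegree_eq_one_iff.mp (by rw [hmin, ← hdeg, hd1])

end MinimalDegree

/-! ### Value groups and the ramification index -/

section ValueGroup

variable {K Kalg : Type*} [NontriviallyNormedField K] [NormedField Kalg] [NormedAlgebra K Kalg]

theorem logb_zpow_self {q : ℝ} (hq : 1 < q) (n : ℤ) : Real.logb q (q ^ n) = n := by
  rw [← Real.rpow_intCast, Real.logb_rpow (by linarith) hq.ne']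

theorem valueGroup_mono (q : ℝ) {L M : IntermediateField K Kalg} (h : L ≤ M) :
    valueGroup q L ≤ valueGroup q M := by
  rintro s ⟨x, hx, hx0, hs⟩
  exact ⟨x, h hx, hx0, hs⟩

theorem residueField_mono [IsUltrametricDist K] [IsUltrametricDist Kalg]
    {L M : IntermediateField K Kalg} (h : L ≤ M) : residueField L ≤ residueField M := by
  rintro _ ⟨x, hx, rfl⟩
  exact ⟨x, h hx, rfl⟩

theorem mem_valueGroup {q : ℝ} {L : IntermediateField K Kalg} {s : ℝ} :
    s ∈ valueGroup q L ↔ ∃ x ∈ L, x ≠ 0 ∧ -Real.logb q ‖x‖ = s := by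
  change (∃ x ∈ L, x ≠ 0 ∧ val q x = (s : WithTop ℝ)) ↔ _
  refine exists_congr fun x => and_congr_right fun _ => and_congr_right fun hx0 => ?_
  rw [val, if_neg hx0, WithTop.coe_inj]

theorem valueGroup_bot {q : ℝ} (hq : 1 < q)
    (hdisc : Set.range (fun x : Kˣ => ‖(x : K)‖) = Set.range (fun n : ℤ => q ^ n)) :
    valueGroup q (⊥ : IntermediateField K Kalg) = AddSubgroup.zmultiples (1 : ℝ) := by
  ext s
  rw [mem_valueGroup, AddSubgroup.mem_zmultiples_iff]
  constructor
  · rintro ⟨_, hx, hx0, rfl⟩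
    obtain ⟨c, rfl⟩ := IntermediateField.mem_bot.mp hx
    have hc0 : c ≠ 0 := by rintro rfl; simp at hx0
    obtain ⟨n, hn⟩ := hdisc.le ⟨Units.mk0 c hc0, rfl⟩
    simp only [Units.val_mk0] at hn
    refine ⟨-n, ?_⟩
    rw [norm_algebraMap', ← hn, logb_zpow_self hq]
    simp
  · rintro ⟨n, rfl⟩
    obtain ⟨c, hc⟩ := hdisc.ge ⟨-n, rfl⟩
    simp only at hc
    refine ⟨algebraMap K Kalg c, IntermediateField.algebraMap_mem _ _, by simp, ?_⟩
    rw [norm_algebraMap', hc, logb_zpow_self hq]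
    simp

/-- All embeddings preserve the absolute value, so the norm to `K` of `x` has absolute value `‖x‖ ^
n`. Hence `v(Lˣ)` lies between `ℤ` and `(1/n)ℤ`, in which `ℤ` has index `n`. -/
theorem ramificationIndex_dvd_finrank [IsUltrametricDist K] [CompleteSpace K]
    [Algebra.IsAlgebraic K Kalg] [IsAlgClosed Kalg]
    {q : ℝ} (hq : 1 < q)
    (hdisc : Set.range (fun x : Kˣ => ‖(x : K)‖) = Set.range (fun n : ℤ => q ^ n))
    (L : IntermediateField K Kalg)
    [FiniteDimensional K L] [Algebra.IsSeparable K L] :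
    ramificationIndex q L ∣ Module.finrank K L := by
  set n := Module.finrank K L with hn
  have hn0 : (n : ℝ) ≠ 0 := by exact_mod_cast (Module.finrank_pos (R := K) (M := L)).ne'
  let φ : ℤ →+ ℝ := (zmultiplesHom ℝ) (1 / n : ℝ)
  have hφ (k : ℤ) : φ k = k / n := by simp [φ, div_eq_mul_inv]
  have hφinj : Function.Injective φ := by
    intro k l hkl
    rw [hφ, hφ, div_left_inj' hn0] at hkl
    exact_mod_cast hkl
  have h1 : valueGroup q (⊥ : IntermediateField K Kalg) =
      (AddSubgroup.zmultiples (n : ℤ)).map φ := by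
    rw [valueGroup_bot hq hdisc, AddMonoidHom.map_zmultiples, hφ]
    simp [hn0]
  have h2 : valueGroup q L ≤ (⊤ : AddSubgroup ℤ).map φ := by
    intro s hs
    obtain ⟨x, hx, hx0, rfl⟩ := mem_valueGroup.mp hs
    set c := Algebra.norm K (⟨x, hx⟩ : L) with hc
    have hnorm : ‖c‖ = ‖x‖ ^ n := by
      rw [← norm_algebraMap' Kalg c, hc, Algebra.norm_eq_prod_embeddings, norm_prod,
        Finset.prod_congr rfl fun σ _ => norm_algHom σ L.val _, Finset.prod_const,
        Finset.card_univ, AlgHom.card]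
      rfl
    have hc0 : c ≠ 0 := norm_ne_zero_iff.mp (hnorm ▸ pow_ne_zero _ (norm_ne_zero_iff.mpr hx0))
    obtain ⟨k, hk⟩ := hdisc.le ⟨Units.mk0 c hc0, rfl⟩
    simp only [Units.val_mk0] at hk
    refine ⟨-k, AddSubgroup.mem_top _, ?_⟩
    have h3 := congrArg (Real.logb q) (hk.trans hnorm)
    rw [logb_zpow_self hq, Real.logb_pow] at h3
    rw [hφ]
    push_cast
    rw [h3]
    field_simp
  have h3 : (valueGroup q (⊥ : IntermediateField K Kalg)).relIndex
      ((⊤ : AddSubgroup ℤ).map φ) = n := by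
    rw [h1, AddSubgroup.relIndex_map_map_of_injective _ _ hφinj, AddSubgroup.relIndex_top_right,
      Int.index_zmultiples, Int.natAbs_natCast]
  have h4 := AddSubgroup.relIndex_mul_relIndex _ _ _ (valueGroup_mono q (bot_le (a := L))) h2
  rw [h3] at h4
  exact ⟨_, h4.symm⟩

end ValueGroup

/-! ### The minimal degree in terms of the residue characteristic -/

section Degrees

theorem norm_natCast_eq_one {K : Type*} [NormedField K] [IsUltrametricDist K] {m : ℕ}
    (h : (m : Residue K) ≠ 0) : ‖(m : K)‖ = 1 := by
  refine le_antisymm (IsUltrametricDist.norm_natCast_le_one K m) (not_lt.mp fun hlt => h ?_)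
  have := (residue_eq_zero_iff_norm (m : Integers K)).mpr (by simpa using hlt)
  simpa using this

variable {K Kalg : Type*} [NontriviallyNormedField K] [NormedField Kalg] [NormedAlgebra K Kalg]
  [IsUltrametricDist K] [IsUltrametricDist Kalg]
  [CompleteSpace K] [Normal K Kalg] [IsAlgClosed Kalg] {ρ : ℝ} {α β : Kalg}

/-- The case `k = 1` of the Hasse derivative argument: the degree is a unit, and the resulting
linear polynomial vanishes at the mean of the conjugates of `α`. -/
theorem IsMinimalInDisk.natDegree_eq_one (hα : IsMinimalInDisk K ρ β α)
    (h : IsInvariantDisk K ρ β) (hρ : 0 < ρ) [CharZero (Residue K)] :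
    (minpoly K α).natDegree = 1 := by
  have hpos := minpoly.natDegree_pos (Algebra.IsIntegral.isIntegral (R := K) α)
  obtain ⟨γ, hγ, hle⟩ := h.exists_natDegree_le hρ hα.mem one_pos hpos
    (norm_natCast_eq_one (by rw [Nat.choose_one_right]; exact_mod_cast hpos.ne'))
  have := hα.natDegree_le γ hγ
  omega

/-- In residue characteristic `p`, the minimal degree in an invariant disk is at most the `p`-part
of the degree of any element. -/
theorem IsMinimalInDisk.natDegree_le_prime_pow (hα : IsMinimalInDisk K ρ β α)
    (h : IsInvariantDisk K ρ β) (hρ : 0 < ρ) {p : ℕ} (hp : p.Prime) [CharP (Residue K) p]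
    {γ : Kalg} (hγ : ‖γ - β‖ ≤ ρ) {j u : ℕ} (hu : ¬ p ∣ u)
    (hdeg : (minpoly K γ).natDegree = p ^ j * u) : (minpoly K α).natDegree ≤ p ^ j := by
  have := Fact.mk hp
  have hu0 : 0 < u := Nat.pos_of_ne_zero (by rintro rfl; simp at hu)
  have hc : ((minpoly K γ).natDegree.choose (p ^ j) : Residue K) ≠ 0 := by
    rw [Ne, CharP.cast_eq_zero_iff (Residue K) p, hdeg]
    -- By Lucas, `(p ^ j * u).choose (p ^ j)` is congruent to `u` modulo `p`, hence nonzero in the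
    -- residue field.
    have := Choose.choose_pow_mul_pow_mul_modEq_choose_nat (p := p) (k := j) (a := u) (b := 1)
    rw [mul_one, Nat.choose_one_right] at this
    rwa [this.dvd_iff dvd_rfl]
  obtain ⟨δ, hδ, hle⟩ := h.exists_natDegree_le hρ hγ (pow_pos hp.pos j)
    (hdeg ▸ Nat.le_mul_of_pos_right _ hu0) (norm_natCast_eq_one hc)
  exact (hα.natDegree_le δ hδ).trans hle

theorem IsMinimalInDisk.exists_natDegree_eq_prime_pow (hα : IsMinimalInDisk K ρ β α)
    (h : IsInvariantDisk K ρ β) (hρ : 0 < ρ) {p : ℕ} (hp : p.Prime) [CharP (Residue K) p] :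
    ∃ j, (minpoly K α).natDegree = p ^ j := by
  have hpos := minpoly.natDegree_pos (Algebra.IsIntegral.isIntegral (R := K) α)
  obtain ⟨j, u, hu, hdeg⟩ := Nat.exists_eq_pow_mul_and_not_dvd hpos.ne' p hp.ne_one
  refine ⟨j, le_antisymm (hα.natDegree_le_prime_pow h hρ hp hα.mem hu hdeg) ?_⟩
  rw [hdeg]
  exact Nat.le_mul_of_pos_right _ (Nat.pos_of_ne_zero (by rintro rfl; simp at hu))

/-- The minimal degree is a power of `p` bounded by the `p`-part of the degree of `γ`, so it divides
that `p`-part. -/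
theorem IsMinimalInDisk.natDegree_dvd (hα : IsMinimalInDisk K ρ β α)
    (h : IsInvariantDisk K ρ β) (hρ : 0 < ρ) {p : ℕ} (hp : p.Prime) [CharP (Residue K) p]
    {γ : Kalg} (hγ : ‖γ - β‖ ≤ ρ) : (minpoly K α).natDegree ∣ (minpoly K γ).natDegree := by
  have hpos := minpoly.natDegree_pos (Algebra.IsIntegral.isIntegral (R := K) γ)
  obtain ⟨j, hj⟩ := hα.exists_natDegree_eq_prime_pow h hρ hp
  obtain ⟨k, u, hu, hdeg⟩ := Nat.exists_eq_pow_mul_and_not_dvd hpos.ne' p hp.ne_one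
  have hle := hα.natDegree_le_prime_pow h hρ hp hγ hu hdeg
  rw [hj] at hle
  rw [hj, hdeg]
  exact (pow_dvd_pow p ((Nat.pow_le_pow_iff_right hp.one_lt).mp hle)).mul_right u

theorem IsMinimalInDisk.isWeaklyTotallyWildlyRamified (hα : IsMinimalInDisk K ρ β α)
    (h : IsInvariantDisk K ρ β) (hρ : 0 < ρ) (hsep : IsSeparable K α) {q : ℝ} (hq : 1 < q)
    (hdisc : Set.range (fun x : Kˣ => ‖(x : K)‖) = Set.range (fun n : ℤ => q ^ n)) :
    IsWeaklyTotallyWildlyRamified q K⟮α⟯ := by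
  have hw := hα.isWeaklyTotallyRamified h hρ
  refine ⟨hw, ?_⟩
  have := hw.1
  have : Algebra.IsSeparable K K⟮α⟯ :=
    (IntermediateField.isSeparable_adjoin_simple_iff_isSeparable K Kalg).mpr hsep
  have hdvd := ramificationIndex_dvd_finrank hq hdisc K⟮α⟯
  rw [IntermediateField.adjoin.finrank (Algebra.IsIntegral.isIntegral α)] at hdvd
  rcases CharP.char_is_prime_or_zero (Residue K) (ringChar (Residue K)) with hp | h0
  · obtain ⟨j, hj⟩ := hα.exists_natDegree_eq_prime_pow h hρ hp
    rw [hj] at hdvd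
    obtain ⟨m, -, hm⟩ := (Nat.dvd_prime_pow hp).mp hdvd
    exact ⟨m, hm⟩
  · have : CharP (Residue K) 0 := ringChar.of_eq h0
    have : CharZero (Residue K) := CharP.charP_to_charZero _
    rw [hα.natDegree_eq_one h hρ, Nat.dvd_one] at hdvd
    exact ⟨0, by rw [hdvd, pow_zero]⟩

end Degrees

/-! ### Disks in the completion -/

section Completion

instance {F : Type*} [NormedField F] [IsUltrametricDist F] :
    IsUltrametricDist (UniformSpace.Completion F) :=
  IsUltrametricDist.isUltrametricDist_of_forall_norm_add_le_max_norm fun x y => by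
    induction x, y using UniformSpace.Completion.induction_on₂ with
    | hp => exact isClosed_le (by fun_prop) (by fun_prop)
    | ih x y =>
      rw [← UniformSpace.Completion.coe_add]
      simpa only [UniformSpace.Completion.norm_coe] using IsUltrametricDist.norm_add_le_max x y

theorem mem_disk_top {F : Type*} [NormedField F] {q : ℝ} {a b : F} : b ∈ disk q a ⊤ ↔ b = a := by
  rw [disk, Set.mem_ofPred_eq, top_le_iff, val, ← sub_eq_zero (a := b)]
  split_ifs with h <;> simp [h]

theorem mem_disk_coe {F : Type*} [NormedField F] {q : ℝ} (hq : 1 < q) {a b : F} {r : ℝ} :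
    b ∈ disk q a r ↔ ‖b - a‖ ≤ q ^ (-r) := by
  rw [disk, Set.mem_ofPred_eq, val]
  split_ifs with h
  · simp [h, Real.rpow_nonneg (zero_le_one.trans hq.le)]
  · rw [WithTop.coe_le_coe, le_neg, Real.logb_le_iff_le_rpow hq (norm_pos_iff.mpr h)]

end Completion

end RamifiedApproximation

/-! ### The main theorem -/

theorem mainTheorem1
    -- the complete discretely valued field, with absolute value `|x| = q ^ (-v x)`, `v (Kˣ) = ℤ`
    {K : Type*} [NontriviallyNormedField K] [IsUltrametricDist K] [CompleteSpace K]
    (q : ℝ) (hq : 1 < q)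
    (hdisc : Set.range (fun x : Kˣ => ‖(x : K)‖) = Set.range (fun n : ℤ => q ^ n))
    -- its algebraic closure, with the unique extension of the absolute value
    {Kalg : Type*} [NormedField Kalg] [NormedAlgebra K Kalg] [IsUltrametricDist Kalg]
    [IsAlgClosure K Kalg]
    (β : Kalg)
    -- the disk `D(a, r)` in the completion of `Kalg`
    (a : UniformSpace.Completion Kalg) (r : WithTop ℝ)
    (hD : ∀ σ : Kalg ≃ₐ[K] Kalg, RamifiedApproximation.galAct σ ''
      RamifiedApproximation.disk q a r = RamifiedApproximation.disk q a r)
    (hβ : (β : UniformSpace.Completion Kalg) ∈ RamifiedApproximation.disk q a r)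
    (hr : r = ⊤ → IsSeparable K β) :
    ∃ α : Kalg,
      (α : UniformSpace.Completion Kalg) ∈ RamifiedApproximation.disk q a r ∧
      Algebra.IsSeparable K K⟮α⟯ ∧
      RamifiedApproximation.IsWeaklyTotallyWildlyRamified q K⟮α⟯ ∧
      RamifiedApproximation.residueField (⊥ : IntermediateField K Kalg) ≤
        RamifiedApproximation.residueField K⟮α⟯ ∧
      RamifiedApproximation.residueField K⟮α⟯ ≤ RamifiedApproximation.residueField K⟮β⟯ ∧
      RamifiedApproximation.valueGroup q (⊥ : IntermediateField K Kalg) ≤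
        RamifiedApproximation.valueGroup q K⟮α⟯ ∧
      RamifiedApproximation.valueGroup q K⟮α⟯ ≤ RamifiedApproximation.valueGroup q K⟮β⟯ ∧
      (CharZero (RamifiedApproximation.Residue K) → α ∈ Set.range (algebraMap K Kalg)) ∧
      (∀ p : ℕ, p.Prime → CharP (RamifiedApproximation.Residue K) p →
        (∃ m : ℕ, Module.finrank K K⟮α⟯ = p ^ m) ∧
        Module.finrank K K⟮α⟯ ∣ Module.finrank K K⟮β⟯) := by
  open RamifiedApproximation in
  have : IsAlgClosed Kalg := IsAlgClosure.isAlgClosed K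
  have : Normal K Kalg := IsAlgClosure.normal K Kalg
  have hσβ (σ : Kalg ≃ₐ[K] Kalg) : ((σ β : Kalg) : UniformSpace.Completion Kalg) ∈ disk q a r := by
    rw [← hD σ, ← galAct_coe]
    exact Set.mem_image_of_mem _ hβ
  -- The disk in the completion is replaced by one centred at `β` with finite positive radius,
  -- inside `Kalg`.
  suffices ∃ (ρ : ℝ) (α : Kalg), 0 < ρ ∧ IsInvariantDisk K ρ β ∧ IsMinimalInDisk K ρ β α ∧
      IsSeparable K α ∧ (α : UniformSpace.Completion Kalg) ∈ disk q a r by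
    obtain ⟨ρ, α, hρ, h, hα, hsep, hmem⟩ := this
    have hβρ : ‖β - β‖ ≤ ρ := by simpa using hρ.le
    refine ⟨α, hmem, (IntermediateField.isSeparable_adjoin_simple_iff_isSeparable K Kalg).mpr hsep,
      hα.isWeaklyTotallyWildlyRamified h hρ hsep hq hdisc, residueField_mono bot_le,
      hα.residueField_le hβρ, valueGroup_mono q bot_le, hα.valueGroup_le q hβρ, fun _ => ?_,
      fun p hp _ => ?_⟩
    · exact minpoly.natDegree_eq_one_iff.mp (hα.natDegree_eq_one h hρ)
    · rw [IntermediateField.adjoin.finrank (Algebra.IsIntegral.isIntegral α),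
        IntermediateField.adjoin.finrank (Algebra.IsIntegral.isIntegral β)]
      exact ⟨hα.exists_natDegree_eq_prime_pow h hρ hp, hα.natDegree_dvd h hρ hp hβρ⟩
  induction r using WithTop.recTopCoe with
  | top =>
    -- For `r = ∞` the disk is a point, so `β` is fixed by every automorphism; being separable, it
    -- lies in `K`.
    have hfix (σ : Kalg ≃ₐ[K] Kalg) : σ β = β :=
      UniformSpace.Completion.coe_injective Kalg
        ((mem_disk_top.mp (hσβ σ)).trans (mem_disk_top.mp hβ).symm)
    have hone : (minpoly K β).natDegree = 1 := by
      refine minpoly.natDegree_eq_one_iff.mpr ?_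
      by_contra hne
      obtain ⟨γ, hγ, hconj⟩ := (notMem_iff_exists_ne_and_isConjRoot (hr rfl)
        (IsAlgClosed.splits _)).mp (fun hmem => hne (Algebra.mem_bot.mp hmem))
      obtain ⟨σ, rfl⟩ := isConjRoot_iff_exists_algEquiv.mp hconj.symm
      exact hγ (hfix σ).symm
    -- The radius `1` is arbitrary: an element of degree one is minimal in every disk about it.
    refine ⟨1, β, one_pos, fun σ => by simp [hfix σ], ⟨by simp, fun γ _ => ?_⟩, hr rfl, hβ⟩
    rw [hone]
    exact minpoly.natDegree_pos (Algebra.IsIntegral.isIntegral γ)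
  | coe r =>
    have hρ : 0 < q ^ (-r) := Real.rpow_pos_of_pos (zero_lt_one.trans hq) _
    have hdisk (γ : Kalg) :
        (γ : UniformSpace.Completion Kalg) ∈ disk q a r ↔ ‖γ - β‖ ≤ q ^ (-r) := by
      rw [mem_disk_coe hq] at hβ ⊢
      rw [← norm_sub_le_iff_of_norm_sub_le hβ, ← UniformSpace.Completion.coe_sub,
        UniformSpace.Completion.norm_coe]
    have h : IsInvariantDisk K (q ^ (-r)) β := fun σ => (hdisk _).mp (hσβ σ)
    obtain ⟨α, hα, hsep⟩ := h.exists_isSeparable hρ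
    exact ⟨_, α, hρ, h, hα, hsep, (hdisk α).mpr hα.mem⟩
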